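/- Let $\delta>0$ and let $\psi:\mathbb{N}=\{1,2,\dots\}\to\mathbb{R}_{\ge 0}$ satisfy $\psi(q)=O(q^{-\delta})$ as $q\to\infty$. Let $\mathbf{y}\in\mathbb{R}^2$ and write $|\cdot|$ for the maximum norm on $\mathbb{R}^2$. If $\sum_{q=1}^\infty \psi(q)^2=\infty$, then the set $$\mathscr{A}_{1,2}(\psi,\mathbf{y})=\{\mathbf{x}\in[0,1)^2 : |q\mathbf{x}-\mathbf{p}-\mathbf{y}|<\psi(|q|)\text{ for infinitely many }(q,\mathbf{p})\in(\mathbb{Z}\setminus\{0\})\times\mathbb{Z}^2\}$$ has Lebesgue measure $1$, and so does its subset $$\{\mathbf{x}\in[0,1)^2 : |q\mathbf{x}-\mathbf{p}-\mathbf{y}|<\psi(q)\text{ for infinitely many }(q,\mathbf{p})\in\mathbb{N}\times\mathbb{Z}^2\}.$$ -/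

import Mathlib

open Filter Asymptotics MeasureTheory
open scoped NNReal

/-- The maximum norm of an integer vector, as a natural number. -/
def intMaxNorm {n : ℕ} (q : Fin n → ℤ) : ℕ :=
  Finset.univ.sup fun i => (q i).natAbs

/-- The set `𝒜_{n,m}(ψ, y)` of `(ψ, y)`-approximable `n × m` matrices with entries in `[0,1)`:
those `x` for which `|q x - p - y| < ψ(|q|)` (maximum norms) holds for infinitely many pairs
`(q, p)` in `(ℤⁿ ∖ {0}) × ℤᵐ`. A matrix is a family of rows `x i : Fin m → ℝ`, so that the measure
`volume` on its type is Lebesgue measure on `ℝ^{nm}`; the norm on `Fin m → ℝ` is the maximum norm. -/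
def approximableMatrices (n m : ℕ) (ψ : ℕ → ℝ≥0) (y : Fin m → ℝ) : Set (Fin n → Fin m → ℝ) :=
  {x | (∀ i j, x i j ∈ Set.Ico (0 : ℝ) 1) ∧
    {qp : (Fin n → ℤ) × (Fin m → ℤ) | qp.1 ≠ 0 ∧
      ‖(fun j => (∑ i, (qp.1 i : ℝ) * x i j) - (qp.2 j : ℝ) - y j : Fin m → ℝ)‖
        < (ψ (intMaxNorm qp.1) : ℝ)}.Infinite}

/-- The set of `x ∈ [0,1)ᵐ` for which `|q x - p - y| < ψ(q)` (maximum norm) holds for infinitely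
many pairs `(q, p)` of a positive integer `q` and an integer vector `p ∈ ℤᵐ`. -/
def approximableVectors (m : ℕ) (ψ : ℕ → ℝ≥0) (y : Fin m → ℝ) : Set (Fin m → ℝ) :=
  {x | (∀ j, x j ∈ Set.Ico (0 : ℝ) 1) ∧
    {qp : ℕ × (Fin m → ℤ) | 0 < qp.1 ∧
      ‖(fun j => (qp.1 : ℝ) * x j - (qp.2 j : ℝ) - y j : Fin m → ℝ)‖ < (ψ qp.1 : ℝ)}.Infinite}

/-!
Only the simultaneous case needs work: the set of approximable `1 × 2` matrices contains a copy of
the set of approximable vectors.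

For each `q`, the neighbourhood of radius `ψ(q) / q` of the points `(p + y) / q` is thinned out by
keeping only certain numerators `p`. Let `ε` be small compared with `δ`. All approximations `n / m`
of `y` with `m ≤ q ^ ε` and `|n - m y| < q ^ (-ε) / 2` are equal to a single rational vector `a / k`
in lowest terms (`exists_primitive_approximation`), and `p` is called reduced if no prime factor of
`q` divides both coordinates of `k p + a`. This adapts to inhomogeneous approximation the
restriction to fractions in lowest terms. It has two effects.

* Overlaps. Let `q < r` and `r' = r / gcd(r, q)`. In each coordinate the two neighbourhoods meet in
  measure `O(ψ(q) ψ(r) + ψ(r) / r')` (`volume_nearGrid_inter_le`). The second term is harmless when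
  `r' > r ^ ε`, since the sum of `1 / r' ^ 2` over such `q < r` is bounded by the divisor bound
  (`exists_sum_one_div_sq_le`). When `r' ≤ r ^ ε`, the decay of `ψ` turns an overlap into an
  approximation of `y` of the above kind, which is then equal to `a / k`, and reducedness of the
  numerator for `r` makes the overlap impossible (`IsReducedNumerator.not_both_near`). Hence the
  overlaps sum to `O(S + S ^ 2)`, where `S` is the sum of `ψ(q) ^ 2`.
* Size. In every ball, a positive proportion of the numerators is reduced, because the sum of
  `1 / l ^ 2` over the primes is less than `1`. So the thinned neighbourhoods cover a proportion
  at least `ψ(q) ^ 2 / 2` of each fixed ball, for large `q`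
  (`volume_reducedNeighborhood_inter_closedBall_ge`).

A divergence Borel–Cantelli argument gives positive measure of the limsup set from the first fact;
together with the second it gives full measure without any zero-one law
(`volume_diff_limsup_eq_zero`): suppose that a set `E` of positive measure is missed by a tail of
the sequence. Take an open set `U ⊇ E` that is barely larger, and a finite union `V` of disjoint
balls in `U` with at least half the measure of `E`. The sets of the sequence occupy their share
of `V` while being confined there to the tiny set `U \ E`, against Cauchy–Schwarz.
-/

/-! ### Arithmetic estimates -/

/-- The divisor bound `τ(n) ≪ n ^ ε`. -/
theorem exists_card_divisors_le_rpow {ε : ℝ} (hε : 0 < ε) :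
    ∃ C : ℝ, 0 < C ∧ ∀ n : ℕ, n ≠ 0 → (n.divisors.card : ℝ) ≤ C * (n : ℝ) ^ ε := by
  have h2 : (1 : ℝ) < 2 ^ ε := Real.one_lt_rpow (by norm_num) hε
  set t : ℝ := 2 ^ ε - 1 with ht
  have htpos : 0 < t := by linarith
  set M : ℝ := max 1 (1 / t)
  have hM1 : 1 ≤ M := le_max_left _ _
  have hMt : 1 ≤ M * t := by
    have : 1 / t ≤ M := le_max_right _ _
    rwa [div_le_iff₀ htpos] at this
  obtain ⟨B, hB⟩ := exists_nat_ge ((2 : ℝ) ^ (1 / ε))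
  have hBε : ∀ p : ℕ, B ≤ p → (2 : ℝ) ≤ (p : ℝ) ^ ε := by
    intro p hp
    have h : (2 : ℝ) ^ (1 / ε) ≤ p := hB.trans (by exact_mod_cast hp)
    calc (2 : ℝ) = ((2 : ℝ) ^ (1 / ε)) ^ ε := by
          rw [← Real.rpow_mul (by norm_num), one_div_mul_cancel hε.ne', Real.rpow_one]
      _ ≤ (p : ℝ) ^ ε := Real.rpow_le_rpow (by positivity) h hε.le
  have key : ∀ p a : ℕ, 2 ≤ p →
      ((a + 1 : ℕ) : ℝ) ≤ (if p < B then M else 1) * ((p : ℝ) ^ ε) ^ a := by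
    intro p a hp
    split_ifs with h
    · have h1 : 1 + (a : ℝ) * t ≤ (1 + t) ^ a := one_add_mul_le_pow (by linarith) a
      have h3 : (1 + t) ^ a ≤ ((p : ℝ) ^ ε) ^ a := by
        apply pow_le_pow_left₀ (by linarith)
        rw [ht, add_sub_cancel]
        exact Real.rpow_le_rpow (by norm_num) (by exact_mod_cast hp) hε.le
      have ha : (0 : ℝ) ≤ a := a.cast_nonneg
      push_cast
      calc (a : ℝ) + 1 ≤ M * (1 + a * t) := by nlinarith
        _ ≤ _ := mul_le_mul_of_nonneg_left (h1.trans h3) (by linarith)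
    · have h1 : 1 + (a : ℝ) * 1 ≤ (1 + 1) ^ a := one_add_mul_le_pow (by norm_num) a
      have h3 : (1 + 1 : ℝ) ^ a ≤ ((p : ℝ) ^ ε) ^ a := by
        apply pow_le_pow_left₀ (by norm_num)
        linarith [hBε p (not_lt.1 h)]
      push_cast
      linarith
  refine ⟨M ^ B, by positivity, fun n hn => ?_⟩
  have hn' : (n : ℝ) ^ ε = ∏ p ∈ n.primeFactors, ((p : ℝ) ^ ε) ^ (n.factorization p) := by
    conv_lhs => rw [← Nat.prod_factorization_pow_eq_self hn]
    rw [Finsupp.prod, Nat.support_factorization, Nat.cast_prod,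
      ← Real.finsetProd_rpow _ _ (fun _ _ => by positivity)]
    refine Finset.prod_congr rfl fun p _ => ?_
    rw [Nat.cast_pow, ← Real.rpow_natCast, ← Real.rpow_natCast, ← Real.rpow_mul (by positivity),
      ← Real.rpow_mul (by positivity), mul_comm]
  rw [Nat.card_divisors hn, Nat.cast_prod, hn']
  calc _ ≤ ∏ p ∈ n.primeFactors, (if p < B then M else 1) * ((p : ℝ) ^ ε) ^ (n.factorization p) :=
        Finset.prod_le_prod (fun _ _ => by positivity)
          fun p hp => key p _ (Nat.prime_of_mem_primeFactors hp).two_le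
    _ = (∏ p ∈ n.primeFactors, if p < B then M else 1) * _ := Finset.prod_mul_distrib
    _ ≤ _ := by
      refine mul_le_mul_of_nonneg_right ?_ (Finset.prod_nonneg fun _ _ => by positivity)
      rw [← Finset.prod_filter, Finset.prod_const]
      apply pow_le_pow_right₀ hM1
      calc _ ≤ (Finset.range B).card := Finset.card_le_card fun p hp => by
            simpa using (Finset.mem_filter.1 hp).2
        _ = B := Finset.card_range B

/-- The moduli `q < r` for which `r / gcd(r, q)` is large contribute boundedly to the sum of
`(r / gcd(r, q))⁻²`: grouping by `e = r / gcd(r, q)` leaves at most `e` moduli for each divisor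
`e` of `r`, hence a sum of `1 / e` over the divisors `e > r ^ ε`. -/
theorem exists_sum_one_div_sq_le {ε : ℝ} (hε : 0 < ε) :
    ∃ D : ℝ, 0 < D ∧ ∀ r : ℕ, r ≠ 0 →
      ∑ q ∈ (Finset.range r).filter (fun q => (r : ℝ) ^ ε < ((r / r.gcd q : ℕ) : ℝ)),
        1 / ((r / r.gcd q : ℕ) : ℝ) ^ 2 ≤ D := by
  obtain ⟨C, hC, h⟩ := exists_card_divisors_le_rpow hε
  refine ⟨C, hC, fun r hr => ?_⟩
  have hr' : (0 : ℝ) < r := by exact_mod_cast Nat.pos_of_ne_zero hr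
  have hrε : 0 < (r : ℝ) ^ ε := by positivity
  set s := (Finset.range r).filter (fun q => (r : ℝ) ^ ε < ((r / r.gcd q : ℕ) : ℝ))
  have hmaps : ∀ q ∈ s, r.gcd q ∈ r.divisors := fun q _ =>
    Nat.mem_divisors.2 ⟨Nat.gcd_dvd_left _ _, hr⟩
  rw [← Finset.sum_fiberwise_of_maps_to hmaps]
  calc _ ≤ ∑ d ∈ r.divisors, 1 / (r : ℝ) ^ ε := by
        refine Finset.sum_le_sum fun d hd => ?_
        have hdvd := (Nat.mem_divisors.1 hd).1
        have hcong : ∀ q ∈ s.filter (fun q => r.gcd q = d),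
            1 / ((r / r.gcd q : ℕ) : ℝ) ^ 2 = 1 / ((r / d : ℕ) : ℝ) ^ 2 := fun q hq => by
          rw [(Finset.mem_filter.1 hq).2]
        rw [Finset.sum_congr rfl hcong, Finset.sum_const, nsmul_eq_mul]
        by_cases hlt : (r : ℝ) ^ ε < ((r / d : ℕ) : ℝ)
        · have hcard : (s.filter (fun q => r.gcd q = d)).card ≤ r / d := by
            calc _ ≤ ((Finset.range r).filter (fun q => r.gcd q = d)).card :=
                  Finset.card_le_card (Finset.filter_subset_filter _ (Finset.filter_subset _ _))
              _ = (r / d).totient := (Nat.totient_div_of_dvd hdvd).symm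
              _ ≤ r / d := Nat.totient_le _
          have he : (0 : ℝ) < ((r / d : ℕ) : ℝ) := hrε.trans hlt
          calc _ ≤ ((r / d : ℕ) : ℝ) * (1 / ((r / d : ℕ) : ℝ) ^ 2) := by
                gcongr
            _ = 1 / ((r / d : ℕ) : ℝ) := by field_simp
            _ ≤ _ := one_div_le_one_div_of_le hrε hlt.le
        · have : s.filter (fun q => r.gcd q = d) = ∅ := by
            refine Finset.filter_eq_empty_iff.2 fun q hq hqd => hlt ?_
            have := (Finset.mem_filter.1 hq).2
            rwa [hqd] at this
          rw [this]
          simp only [Finset.card_empty, Nat.cast_zero, zero_mul]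
          positivity
    _ = (r.divisors.card : ℝ) * (1 / (r : ℝ) ^ ε) := by rw [Finset.sum_const, nsmul_eq_mul]
    _ ≤ C := by
      rw [mul_one_div, div_le_iff₀ hrε]
      exact h r hr

theorem sum_primeFactors_one_div_sq_le (n : ℕ) :
    ∑ p ∈ n.primeFactors, 1 / (p : ℝ) ^ 2 ≤ 3 / 4 := by
  have key : ∀ m : ℕ, ∑ k ∈ Finset.Ico 2 (m + 3), 1 / (k : ℝ) ^ 2 ≤ 3 / 4 - 1 / ((m : ℝ) + 2) := by
    intro m
    induction m with
    | zero => norm_num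
    | succ m ih =>
      rw [Finset.sum_Ico_succ_top (by omega)]
      refine (add_le_add_left ih _).trans ?_
      push_cast
      have : (1 : ℝ) / (m + 3) ^ 2 ≤ 1 / (m + 2) - 1 / (m + 3) := by
        rw [div_sub_div _ _ (by positivity) (by positivity), div_le_div_iff₀ (by positivity)
          (by positivity)]
        nlinarith [(m.cast_nonneg : (0 : ℝ) ≤ m)]
      have e : (m : ℝ) + 1 + 2 = m + 3 := by ring
      rw [e]
      linarith
  calc _ ≤ ∑ k ∈ Finset.Ico 2 (n + 3), 1 / (k : ℝ) ^ 2 := by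
        refine Finset.sum_le_sum_of_subset_of_nonneg (fun p hp => ?_) fun _ _ _ => by positivity
        have h1 := (Nat.prime_of_mem_primeFactors hp).two_le
        have h2 := Nat.le_of_mem_primeFactors hp
        exact Finset.mem_Ico.2 ⟨h1, by omega⟩
    _ ≤ 3 / 4 - 1 / ((n : ℝ) + 2) := key n
    _ ≤ 3 / 4 := by
      have : (0 : ℝ) ≤ 1 / ((n : ℝ) + 2) := by positivity
      linarith

/-- An interval of length `L` contains at most `L / m + 1` integers of a residue class
modulo `m`. -/
theorem card_le_div_add_one {s : Finset ℤ} {m : ℕ} (hm : 0 < m) {L : ℝ}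
    (hL : 0 ≤ L) (hdvd : ∀ a ∈ s, ∀ b ∈ s, (m : ℤ) ∣ a - b)
    (hdist : ∀ a ∈ s, ∀ b ∈ s, ((a - b : ℤ) : ℝ) ≤ L) : (s.card : ℝ) ≤ L / m + 1 := by
  have hm' : (0 : ℝ) < m := by exact_mod_cast hm
  rcases s.eq_empty_or_nonempty with rfl | hs
  · simp only [Finset.card_empty, Nat.cast_zero]
    positivity
  set a₀ := s.min' hs
  have ha₀ : a₀ ∈ s := s.min'_mem hs
  have hmaps : Set.MapsTo (fun a : ℤ => ((a - a₀) / m).toNat) s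
      (Finset.range (⌊L / m⌋₊ + 1)) := by
    intro a ha
    obtain ⟨c, hc⟩ := hdvd a ha a₀ ha₀
    have h1 := hdist a ha a₀ ha₀
    have h2 : a₀ ≤ a := s.min'_le a ha
    have hc0 : 0 ≤ c := by
      by_contra! hneg
      nlinarith [(by exact_mod_cast hm : (0 : ℤ) < m)]
    simp only [Finset.coe_range, Set.mem_Iio, Order.lt_add_one_iff]
    rw [hc, Int.mul_ediv_cancel_left _ (by exact_mod_cast hm.ne')]
    apply Nat.le_floor
    rw [le_div_iff₀ hm']
    have h3 : ((c.toNat : ℕ) : ℝ) = (c : ℝ) := by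
      exact_mod_cast congrArg (Int.cast : ℤ → ℝ) (Int.toNat_of_nonneg hc0)
    rw [h3, mul_comm]
    rw [hc] at h1
    exact_mod_cast h1
  have hinj : Set.InjOn (fun a : ℤ => ((a - a₀) / m).toNat) s := by
    intro a ha b hb hab
    have h2 : a₀ ≤ a := s.min'_le a ha
    have h3 : a₀ ≤ b := s.min'_le b hb
    have hm0 : (0 : ℤ) ≤ m := by positivity
    have e1 := Int.toNat_of_nonneg (Int.ediv_nonneg (sub_nonneg.2 h2) hm0)
    have e2 := Int.toNat_of_nonneg (Int.ediv_nonneg (sub_nonneg.2 h3) hm0)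
    have e3 : (a - a₀) / (m : ℤ) = (b - a₀) / m := by
      rw [← e1, ← e2]
      exact congrArg _ hab
    have := (Int.ediv_left_inj (hdvd a ha a₀ ha₀) (hdvd b hb a₀ ha₀)).1 e3
    linarith
  have := Finset.card_le_card_of_injOn _ hmaps hinj
  rw [Finset.card_range] at this
  calc (s.card : ℝ) ≤ ((⌊L / m⌋₊ + 1 : ℕ) : ℝ) := by exact_mod_cast this
    _ ≤ L / m + 1 := by
      push_cast
      gcongr
      exact Nat.floor_le (by positivity)

/-! ### Overlaps in dimension one -/

/-- The points `x` of `[0, 1)` at distance less than `α / q` from the grid `(ℤ + y) / q`. -/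
def nearGrid (q : ℕ) (α y : ℝ) : Set ℝ :=
  {x | x ∈ Set.Ico (0 : ℝ) 1 ∧ ∃ p : ℤ, |(q : ℝ) * x - p - y| < α}

/-- The bound for the intersection of two grid neighbourhoods: intersecting intervals with centres
`(p + y) / q` and `(b + y) / r` are counted by the values of `r' p - q' b` (an integer restricted to
an interval) and, for each value, by the residue class of `p` modulo `q'`, where `q'` and `r'` are
`q` and `r` divided by their gcd. -/
theorem volume_nearGrid_inter_le {q r : ℕ} (hq : 0 < q) (hr : 0 < r) {α β y : ℝ}
    (hα0 : 0 ≤ α) (hα : α ≤ 1 / 2) (hβ0 : 0 ≤ β) (hβ : β ≤ 1 / 2) :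
    volume.real (nearGrid q α y ∩ nearGrid r β y) ≤
      24 * α * β + 6 * β / ((r / r.gcd q : ℕ) : ℝ) := by
  set d := r.gcd q
  have hd : 0 < d := Nat.gcd_pos_of_pos_left _ hr
  obtain ⟨q', hq'⟩ : d ∣ q := Nat.gcd_dvd_right _ _
  obtain ⟨r', hr'⟩ : d ∣ r := Nat.gcd_dvd_left _ _
  have hq'0 : 0 < q' := Nat.pos_of_mul_pos_left (hq' ▸ hq)
  have hr'0 : 0 < r' := Nat.pos_of_mul_pos_left (hr' ▸ hr)
  have hcop : Nat.Coprime r' q' := by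
    have := Nat.coprime_div_gcd_div_gcd hd
    rwa [Nat.div_eq_of_eq_mul_right hd hr', Nat.div_eq_of_eq_mul_right hd hq'] at this
  rw [Nat.div_eq_of_eq_mul_right hd hr']
  have hqR : (q : ℝ) = d * q' := by exact_mod_cast hq'
  have hrR : (r : ℝ) = d * r' := by exact_mod_cast hr'
  have hdp : (1 : ℝ) ≤ d := by exact_mod_cast hd
  have hq'p : (1 : ℝ) ≤ q' := by exact_mod_cast hq'0
  have hr'p : (1 : ℝ) ≤ r' := by exact_mod_cast hr'0
  have hqp : (1 : ℝ) ≤ q := by exact_mod_cast hq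
  have hrp : (1 : ℝ) ≤ r := by exact_mod_cast hr
  clear_value d
  set R : ℝ := r' * α + q' * β with hR
  have hR0 : 0 ≤ R := by positivity
  obtain ⟨M, hM⟩ := exists_nat_ge ((q : ℝ) + r + |y| + 1)
  classical
  set P : Finset (ℤ × ℤ) := ((Finset.Icc (-(M : ℤ)) M) ×ˢ (Finset.Icc (-(M : ℤ)) M)).filter
    (fun pb => ∃ x ∈ Set.Ico (0 : ℝ) 1, |(q : ℝ) * x - pb.1 - y| < α ∧ |(r : ℝ) * x - pb.2 - y| < β)
    with hP
  have hPx : ∀ pb ∈ P, ∃ x ∈ Set.Ico (0 : ℝ) 1,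
      |(q : ℝ) * x - pb.1 - y| < α ∧ |(r : ℝ) * x - pb.2 - y| < β := fun pb hpb =>
    (Finset.mem_filter.1 hpb).2
  set μ : ℝ := min (α / q) (β / r) with hμ
  have hμ0 : 0 ≤ μ := le_min (by positivity) (by positivity)
  have hsub : nearGrid q α y ∩ nearGrid r β y ⊆ ⋃ pb ∈ P,
      Metric.closedBall (((pb.1 : ℝ) + y) / q) (α / q) ∩
        Metric.closedBall (((pb.2 : ℝ) + y) / r) (β / r) := by
    rintro x ⟨⟨hx, p, hp⟩, ⟨-, b, hb⟩⟩
    have hbd : ∀ (n : ℕ) (γ : ℝ) (c : ℤ), (1 : ℝ) ≤ n → γ ≤ 1 / 2 → (n : ℝ) + |y| + 1 ≤ M →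
        |(n : ℝ) * x - c - y| < γ → c ∈ Finset.Icc (-(M : ℤ)) M := by
      intro n γ c hn hγ hnM hc
      rw [abs_lt] at hc
      have h1 := neg_abs_le y
      have h2 := le_abs_self y
      have h3 : 0 ≤ (n : ℝ) * x := mul_nonneg (by linarith) hx.1
      have h4 : (n : ℝ) * x ≤ n := by nlinarith [hx.2]
      rw [Finset.mem_Icc]
      constructor
      · have : (-(M : ℝ)) ≤ c := by linarith
        exact_mod_cast this
      · have : (c : ℝ) ≤ M := by linarith
        exact_mod_cast this
    have hmem : ∀ (n : ℕ) (γ : ℝ) (c : ℤ), (1 : ℝ) ≤ n → |(n : ℝ) * x - c - y| < γ →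
        x ∈ Metric.closedBall (((c : ℝ) + y) / n) (γ / n) := by
      intro n γ c hn hc
      rw [Metric.mem_closedBall, Real.dist_eq]
      have e : x - ((c : ℝ) + y) / n = ((n : ℝ) * x - c - y) / n := by
        field_simp
        ring
      rw [e, abs_div, abs_of_pos (by linarith : (0 : ℝ) < n)]
      gcongr
    refine Set.mem_iUnion₂.2 ⟨(p, b), ?_, hmem q α p hqp hp, hmem r β b hrp hb⟩
    rw [hP, Finset.mem_filter, Finset.mem_product]
    exact ⟨⟨hbd q α p hqp hα (by linarith) hp, hbd r β b hrp hβ (by linarith) hb⟩, x, hx, hp, hb⟩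
  have hone : ∀ pb ∈ P, volume.real (Metric.closedBall (((pb.1 : ℝ) + y) / q) (α / q) ∩
      Metric.closedBall (((pb.2 : ℝ) + y) / r) (β / r)) ≤ 2 * μ := by
    intro pb _
    rw [hμ, mul_min_of_nonneg _ _ (by norm_num : (0 : ℝ) ≤ 2)]
    refine le_min ?_ ?_
    · refine (measureReal_mono Set.inter_subset_left measure_closedBall_lt_top.ne).trans_eq ?_
      rw [Measure.real, Real.volume_closedBall, ENNReal.toReal_ofReal (by positivity)]
    · refine (measureReal_mono Set.inter_subset_right measure_closedBall_lt_top.ne).trans_eq ?_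
      rw [Measure.real, Real.volume_closedBall, ENNReal.toReal_ofReal (by positivity)]
  set f : ℤ × ℤ → ℤ := fun pb => (r' : ℤ) * pb.1 - (q' : ℤ) * pb.2 with hf
  have hfib : ∀ n ∈ P.image f, (P.filter (fun pb => f pb = n)).card ≤ 3 * d := by
    intro n _
    set T := P.filter (fun pb => f pb = n)
    have hT : ∀ s ∈ T, ∀ t ∈ T, (r' : ℤ) * (s.1 - t.1) = q' * (s.2 - t.2) := by
      intro s hs t ht
      have h1 := (Finset.mem_filter.1 hs).2
      have h2 := (Finset.mem_filter.1 ht).2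
      simp only [hf] at h1 h2
      linarith
    have hinj : Set.InjOn Prod.fst (T : Set (ℤ × ℤ)) := by
      intro s hs t ht hst
      have h := hT s hs t ht
      rw [hst, sub_self, mul_zero] at h
      have hq'z : (q' : ℤ) ≠ 0 := by exact_mod_cast hq'0.ne'
      have h0 : s.2 - t.2 = 0 := by
        rcases mul_eq_zero.1 h.symm with h | h
        · exact absurd h hq'z
        · exact h
      exact Prod.ext hst (by linarith)
    rw [← Finset.card_image_of_injOn hinj]
    have hcard := card_le_div_add_one (s := T.image Prod.fst) hq'0 (L := 2 * q) (by positivity) ?_ ?_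
    · have e : 2 * (q : ℝ) / q' = 2 * d := by
        rw [hqR]; field_simp
      rw [e] at hcard
      have : ((T.image Prod.fst).card : ℝ) ≤ ((3 * d : ℕ) : ℝ) := by
        push_cast
        linarith
      exact_mod_cast this
    · intro a ha b hb
      obtain ⟨s, hs, rfl⟩ := Finset.mem_image.1 ha
      obtain ⟨t, ht, rfl⟩ := Finset.mem_image.1 hb
      exact IsCoprime.dvd_of_dvd_mul_left (Nat.isCoprime_iff_coprime.2 hcop).symm ⟨_, hT s hs t ht⟩
    · intro a ha b hb
      obtain ⟨s, hs, rfl⟩ := Finset.mem_image.1 ha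
      obtain ⟨t, ht, rfl⟩ := Finset.mem_image.1 hb
      obtain ⟨x, hx, hx1, -⟩ := hPx s (Finset.mem_filter.1 hs).1
      obtain ⟨x', hx', hx'1, -⟩ := hPx t (Finset.mem_filter.1 ht).1
      rw [abs_lt] at hx1 hx'1
      have h4 : (q : ℝ) * x ≤ q := by nlinarith [hx.2]
      have h5 : 0 ≤ (q : ℝ) * x' := mul_nonneg (by linarith) hx'.1
      push_cast
      linarith
  have himg : ((P.image f).card : ℝ) ≤ 2 * R + 1 := by
    have := card_le_div_add_one (s := P.image f) one_pos (L := 2 * R) (by positivity)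
      (fun a _ b _ => by simp) ?_
    · simpa using this
    · have hbd : ∀ a ∈ P.image f, |(a : ℝ) + (r' - q') * y| < R := by
        intro a ha
        obtain ⟨s, hs, rfl⟩ := Finset.mem_image.1 ha
        obtain ⟨x, hx, hx1, hx2⟩ := hPx s hs
        have e : ((f s : ℤ) : ℝ) + (r' - q') * y =
            q' * ((r : ℝ) * x - s.2 - y) - r' * ((q : ℝ) * x - s.1 - y) := by
          simp only [hf]
          push_cast
          rw [hqR, hrR]
          ring
        rw [e, abs_lt]
        rw [abs_lt] at hx1 hx2
        constructor <;> nlinarith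
      intro a ha b hb
      have h1 := abs_lt.1 (hbd a ha)
      have h2 := abs_lt.1 (hbd b hb)
      push_cast
      linarith
  have hPcard : (P.card : ℝ) ≤ 3 * d * (2 * R + 1) := by
    have h1 : (P.card : ℝ) ≤ ((3 * d * (P.image f).card : ℕ) : ℝ) := by
      exact_mod_cast Finset.card_le_mul_card_image P (3 * d) hfib
    push_cast at h1
    exact h1.trans (by gcongr)
  have hμα : μ ≤ α / q := min_le_left _ _
  have hμβ : μ ≤ β / r := min_le_right _ _
  have hdRμ : d * R * μ ≤ 2 * α * β := by
    have e : d * R * μ = r * α * μ + q * β * μ := by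
      rw [hR, hqR, hrR]; ring
    have h1 : r * α * μ ≤ α * β := by
      calc r * α * μ ≤ r * α * (β / r) := by gcongr
        _ = α * β := by field_simp
    have h2 : q * β * μ ≤ α * β := by
      calc q * β * μ ≤ q * β * (α / q) := by gcongr
        _ = α * β := by field_simp
    linarith
  have hdμ : d * μ ≤ β / r' := by
    calc d * μ ≤ d * (β / r) := by gcongr
      _ = β / r' := by rw [hrR]; field_simp
  calc volume.real (nearGrid q α y ∩ nearGrid r β y)
      ≤ volume.real (⋃ pb ∈ P, Metric.closedBall (((pb.1 : ℝ) + y) / q) (α / q) ∩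
        Metric.closedBall (((pb.2 : ℝ) + y) / r) (β / r)) := by
        refine measureReal_mono hsub (measure_biUnion_lt_top P.finite_toSet fun pb _ => ?_).ne
        exact measure_lt_top_of_subset Set.inter_subset_left measure_closedBall_lt_top.ne
    _ ≤ ∑ pb ∈ P, volume.real (Metric.closedBall (((pb.1 : ℝ) + y) / q) (α / q) ∩
        Metric.closedBall (((pb.2 : ℝ) + y) / r) (β / r)) := measureReal_biUnion_finset_le _ _
    _ ≤ P.card * (2 * μ) := by
        rw [← nsmul_eq_mul]
        exact Finset.sum_le_card_nsmul _ _ _ hone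
    _ ≤ 3 * d * (2 * R + 1) * (2 * μ) := by gcongr
    _ = 12 * (d * R * μ) + 6 * (d * μ) := by ring
    _ ≤ 24 * α * β + 6 * β / r' := by
        have e : 6 * β / (r' : ℝ) = 6 * (β / r') := by ring
        rw [e]
        linarith

/-! ### A limsup lemma -/

/-- Cauchy–Schwarz for a sum of indicator functions restricted to `W`. -/
theorem sq_sum_measureReal_inter_le {X : Type*} [MeasurableSpace X] (μ : Measure X)
    {A : ℕ → Set X} (hA : ∀ q, MeasurableSet (A q)) (hAfin : ∀ q, μ (A q) ≠ ⊤)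
    {W : Set X} (hW : MeasurableSet W) (hWfin : μ W ≠ ⊤) (s : Finset ℕ) :
    (∑ q ∈ s, μ.real (A q ∩ W)) ^ 2 ≤
      μ.real W * ∑ q ∈ s, ∑ r ∈ s, μ.real (A q ∩ A r) := by
  set I : Set X → X → ℝ := fun S => S.indicator 1
  have hI : ∀ S, MeasurableSet S → μ S ≠ ⊤ → Integrable (I S) μ := fun S h1 h2 =>
    (integrable_indicator_iff h1).2 (integrableOn_const h2)
  have hint : ∀ S, MeasurableSet S → ∫ x, I S x ∂μ = μ.real S := fun S h => integral_indicator_one h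
  have hfin : ∀ q S, μ (A q ∩ S) ≠ ⊤ := fun q S =>
    measure_ne_top_of_subset Set.inter_subset_left (hAfin q)
  have hmul : ∀ S T x, I S x * I T x = I (S ∩ T) x := fun S T x => by
    simp only [I, Set.inter_indicator_one, Pi.mul_apply]
  set a := μ.real W
  set b := ∑ q ∈ s, μ.real (A q ∩ W)
  set c := ∑ q ∈ s, ∑ r ∈ s, μ.real (A q ∩ A r)
  have key : ∀ t : ℝ, 0 ≤ a * (t * t) + (-2 * b) * t + c := by
    intro t
    have hnn : 0 ≤ ∫ x, (∑ q ∈ s, I (A q) x - t * I W x) ^ 2 ∂μ :=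
      integral_nonneg fun _ => sq_nonneg _
    have hexp : ∀ x, (∑ q ∈ s, I (A q) x - t * I W x) ^ 2 =
        (∑ q ∈ s, ∑ r ∈ s, I (A q ∩ A r) x) - 2 * t * (∑ q ∈ s, I (A q ∩ W) x)
          + t * t * I W x := by
      intro x
      simp only [← hmul, ← Finset.sum_mul, ← Finset.mul_sum]
      have : I W x * I W x = I W x := by rw [hmul, Set.inter_self]
      linear_combination t * t * this
    have i1 : Integrable (fun x => ∑ q ∈ s, ∑ r ∈ s, I (A q ∩ A r) x) μ :=
      integrable_finsetSum _ fun q _ => integrable_finsetSum _ fun r _ =>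
        hI _ ((hA q).inter (hA r)) (hfin q _)
    have i2 : Integrable (fun x => ∑ q ∈ s, I (A q ∩ W) x) μ :=
      integrable_finsetSum _ fun q _ => hI _ ((hA q).inter hW) (hfin q _)
    have h1 : ∫ x, ∑ q ∈ s, ∑ r ∈ s, I (A q ∩ A r) x ∂μ = c := by
      rw [integral_finsetSum _ fun q _ => integrable_finsetSum _ fun r _ =>
        hI _ ((hA q).inter (hA r)) (hfin q _)]
      refine Finset.sum_congr rfl fun q _ => ?_
      rw [integral_finsetSum _ fun r _ => hI _ ((hA q).inter (hA r)) (hfin q _)]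
      exact Finset.sum_congr rfl fun r _ => hint _ ((hA q).inter (hA r))
    have h2 : ∫ x, ∑ q ∈ s, I (A q ∩ W) x ∂μ = b := by
      rw [integral_finsetSum _ fun q _ => hI _ ((hA q).inter hW) (hfin q _)]
      exact Finset.sum_congr rfl fun q _ => hint _ ((hA q).inter hW)
    have i12 : Integrable (fun x => (∑ q ∈ s, ∑ r ∈ s, I (A q ∩ A r) x)
        - 2 * t * (∑ q ∈ s, I (A q ∩ W) x)) μ := i1.sub (i2.const_mul _)
    simp_rw [hexp] at hnn
    rw [integral_add i12 ((hI W hW hWfin).const_mul _), integral_sub i1 (i2.const_mul _),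
      integral_const_mul, integral_const_mul, h1, h2, hint W hW] at hnn
    linarith
  have := discrim_le_zero key
  rw [discrim] at this
  nlinarith

/-- Up to an arbitrary loss, an open set of finite measure is filled by finitely many disjoint
closed balls. -/
theorem exists_finset_closedBall_subset {ι : Type*} [Fintype ι] {U : Set (ι → ℝ)}
    (hU : IsOpen U) {m : ENNReal} (hm : m < volume U) :
    ∃ (t : Finset (ι → ℝ)) (ρ : (ι → ℝ) → ℝ), (∀ z ∈ t, 0 < ρ z) ∧
      (∀ z ∈ t, Metric.closedBall z (ρ z) ⊆ U) ∧
      ((t : Set (ι → ℝ)).PairwiseDisjoint fun z => Metric.closedBall z (ρ z)) ∧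
      m < volume (⋃ z ∈ t, Metric.closedBall z (ρ z)) := by
  obtain ⟨t, ρ, htc, -, hρ, hnull, hdisj⟩ := Besicovitch.exists_disjoint_closedBall_covering_ae
    (volume : Measure (ι → ℝ)) (fun z => {ρ | Metric.closedBall z ρ ⊆ U}) U
    (fun z hz δ hδ => by
      obtain ⟨ρ, hρ, hsub⟩ := Metric.isOpen_iff.1 hU z hz
      refine ⟨min (ρ / 2) (δ / 2), (Metric.closedBall_subset_ball ?_).trans hsub, ?_, ?_⟩
      · exact (min_le_left _ _).trans_lt (by linarith)
      · exact lt_min (by linarith) (by linarith)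
      · exact (min_le_right _ _).trans_lt (by linarith))
    (fun _ => 1) (fun _ _ => one_pos)
  have hle : volume U ≤ volume (⋃ z ∈ t, Metric.closedBall z (ρ z)) :=
    measure_mono_ae (ae_le_set.2 hnull)
  rw [measure_biUnion htc hdisj (fun z _ => Metric.isClosed_closedBall.measurableSet)] at hle
  have hlt := hm.trans_le hle
  rw [ENNReal.tsum_eq_iSup_sum] at hlt
  obtain ⟨F, hF⟩ := lt_iSup_iff.1 hlt
  refine ⟨F.map (Function.Embedding.subtype _), ρ, ?_, ?_, ?_, ?_⟩
  · intro z hz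
    obtain ⟨w, -, rfl⟩ := Finset.mem_map.1 hz
    exact (hρ w w.2).2.1
  · intro z hz
    obtain ⟨w, -, rfl⟩ := Finset.mem_map.1 hz
    exact (hρ w w.2).1
  · refine hdisj.subset fun z hz => ?_
    obtain ⟨w, -, rfl⟩ := Finset.mem_map.1 hz
    exact w.2
  · rw [measure_biUnion_finset _ fun z _ => Metric.isClosed_closedBall.measurableSet]
    · simpa using hF
    · refine hdisj.subset fun z hz => ?_
      obtain ⟨w, -, rfl⟩ := Finset.mem_map.1 hz
      exact w.2

/-- A divergence Borel–Cantelli lemma giving full measure: quasi-independence on average together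
with a lower bound for the proportion of each closed ball that is covered by `A q`. -/
theorem volume_diff_limsup_eq_zero {ι : Type*} [Fintype ι] {Ω : Set (ι → ℝ)}
    (hΩ : IsOpen Ω) (hΩfin : volume Ω ≠ ⊤) {A : ℕ → Set (ι → ℝ)}
    (hA : ∀ q, MeasurableSet (A q)) (hAfin : ∀ q, volume (A q) ≠ ⊤)
    {w : ℕ → ℝ} (hw0 : ∀ q, 0 ≤ w q) (hw : ¬ Summable w) {c C : ℝ} (hc : 0 < c) (hC : 0 < C)
    (N₀ : ℕ)
    (hpair : ∀ N Q, N₀ ≤ N → ∑ q ∈ Finset.Ico N Q, ∑ r ∈ Finset.Ico N Q,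
      volume.real (A q ∩ A r) ≤
        C * ((∑ q ∈ Finset.Ico N Q, w q) + (∑ q ∈ Finset.Ico N Q, w q) ^ 2))
    (hloc : ∀ (z : ι → ℝ) (ρ : ℝ), 0 < ρ → Metric.closedBall z ρ ⊆ Ω → ∀ᶠ q in atTop,
      c * w q * volume.real (Metric.closedBall z ρ) ≤
        volume.real (A q ∩ Metric.closedBall z ρ)) :
    volume (Ω \ {x | ∃ᶠ q in atTop, x ∈ A q}) = 0 := by
  have hcover : Ω \ {x | ∃ᶠ q in atTop, x ∈ A q} ⊆ ⋃ N : ℕ, (Ω \ ⋃ q ≥ N, A q) := by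
    rintro x ⟨hx, hx'⟩
    obtain ⟨N, hN⟩ := eventually_atTop.1 (not_frequently.1 hx')
    refine Set.mem_iUnion.2 ⟨N, hx, fun h => ?_⟩
    obtain ⟨q, hq, hxq⟩ := Set.mem_iUnion₂.1 h
    exact hN q hq hxq
  refine measure_mono_null hcover (measure_iUnion_null fun N => ?_)
  set E := Ω \ ⋃ q ≥ N, A q with hE
  have hEm : MeasurableSet E := hΩ.measurableSet.diff
    (MeasurableSet.iUnion fun q => MeasurableSet.iUnion fun _ => hA q)
  have hEfin : volume E ≠ ⊤ := measure_ne_top_of_subset Set.sdiff_subset hΩfin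
  by_contra hpos
  set e := volume.real E with he
  have hepos : 0 < e := ENNReal.toReal_pos hpos hEfin
  -- `κ` is chosen so small that the Cauchy–Schwarz bound on `U \ E` contradicts the local
  -- lower bound on the balls.
  set κ := c ^ 2 * e ^ 2 / (16 * C) with hκ
  have hκpos : 0 < κ := by positivity
  obtain ⟨U₀, hEU₀, hU₀o, -, hU₀⟩ := hEm.exists_isOpen_sdiff_lt hEfin
    (ε := ENNReal.ofReal κ) (by simpa using hκpos)
  set U := U₀ ∩ Ω
  have hUo : IsOpen U := hU₀o.inter hΩ
  have hEU : E ⊆ U := Set.subset_inter hEU₀ Set.sdiff_subset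
  have hUΩ : U ⊆ Ω := Set.inter_subset_right
  have hUfin : volume U ≠ ⊤ := measure_ne_top_of_subset hUΩ hΩfin
  set W := U \ E
  have hWm : MeasurableSet W := hUo.measurableSet.diff hEm
  have hWfin : volume W ≠ ⊤ := measure_ne_top_of_subset Set.sdiff_subset hUfin
  have hWκ : volume.real W ≤ κ := by
    refine ENNReal.toReal_le_of_le_ofReal hκpos.le (le_trans (measure_mono ?_) hU₀.le)
    exact Set.sdiff_subset_sdiff_left Set.inter_subset_left
  obtain ⟨t, ρ, hρ, hsub, hdisj, hmeas⟩ := exists_finset_closedBall_subset hUo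
    (m := ENNReal.ofReal (e / 2)) (by
      calc ENNReal.ofReal (e / 2) < ENNReal.ofReal e := by
            rw [ENNReal.ofReal_lt_ofReal_iff hepos]; linarith
        _ = volume E := ENNReal.ofReal_toReal hEfin
        _ ≤ volume U := measure_mono hEU)
  have hball : ∀ z ∈ t, MeasurableSet (Metric.closedBall z (ρ z)) := fun z _ =>
    Metric.isClosed_closedBall.measurableSet
  set V := ⋃ z ∈ t, Metric.closedBall z (ρ z) with hV
  have hVU : V ⊆ U := Set.iUnion₂_subset hsub
  have hVfin : volume V ≠ ⊤ := measure_ne_top_of_subset hVU hUfin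
  have hVe : e / 2 ≤ volume.real V :=
    (ENNReal.ofReal_le_iff_le_toReal hVfin).1 hmeas.le
  have hVsum : volume.real V = ∑ z ∈ t, volume.real (Metric.closedBall z (ρ z)) :=
    measureReal_biUnion_finset hdisj hball fun _ _ => measure_closedBall_lt_top.ne
  have hlocV : ∀ᶠ q in atTop, c * w q * volume.real V ≤ volume.real (A q ∩ V) := by
    have := (Filter.eventually_all_finset t).2 fun z hz =>
      hloc z (ρ z) (hρ z hz) ((hsub z hz).trans hUΩ)
    filter_upwards [this] with q hq
    have : A q ∩ V = ⋃ z ∈ t, A q ∩ Metric.closedBall z (ρ z) := by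
      rw [hV, Set.inter_iUnion₂]
    rw [this, measureReal_biUnion_finset (fun z hz z' hz' hne =>
        (hdisj hz hz' hne).mono Set.inter_subset_right Set.inter_subset_right)
        (fun z hz => (hA q).inter (hball z hz)) (fun z _ =>
        measure_ne_top_of_subset Set.inter_subset_left (hAfin q)), hVsum, Finset.mul_sum]
    exact Finset.sum_le_sum hq
  obtain ⟨N₁, hN₁⟩ := eventually_atTop.1 hlocV
  set M := max N₀ (max N N₁)
  obtain ⟨Q, hQ⟩ : ∃ Q, 1 ≤ ∑ q ∈ Finset.Ico M Q, w q := by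
    by_contra! hcon
    refine hw ((summable_nat_add_iff M).1 (summable_of_sum_range_le (c := 1)
      (fun q => hw0 _) fun n => ?_))
    have := hcon (M + n)
    rw [Finset.sum_Ico_eq_sum_range, add_tsub_cancel_left] at this
    simp_rw [add_comm M] at this
    exact this.le
  set S := ∑ q ∈ Finset.Ico M Q, w q
  have hS : c * (e / 2) * S ≤ ∑ q ∈ Finset.Ico M Q, volume.real (A q ∩ W) := by
    rw [Finset.mul_sum]
    refine Finset.sum_le_sum fun q hq => ?_
    have hMq := (Finset.mem_Ico.1 hq).1
    have hNq : N ≤ q := ((le_max_left _ _).trans (le_max_right _ _)).trans hMq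
    have hN₁q : N₁ ≤ q := ((le_max_right _ _).trans (le_max_right _ _)).trans hMq
    calc c * (e / 2) * w q ≤ c * w q * volume.real V := by
          have := mul_le_mul_of_nonneg_left hVe (mul_nonneg hc.le (hw0 q))
          linarith
      _ ≤ volume.real (A q ∩ V) := hN₁ q hN₁q
      _ ≤ volume.real (A q ∩ W) := by
        refine measureReal_mono ?_ (measure_ne_top_of_subset Set.inter_subset_left (hAfin q))
        rintro x ⟨hxA, hxV⟩
        refine ⟨hxA, hVU hxV, fun hxE => hxE.2 ?_⟩
        exact Set.mem_iUnion₂.2 ⟨q, hNq, hxA⟩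
  have hCS := sq_sum_measureReal_inter_le volume hA hAfin hWm hWfin (Finset.Ico M Q)
  have hP := hpair M Q (le_max_left _ _)
  have hS0 : 0 < S := by linarith
  have h1 : (c * (e / 2) * S) ^ 2 ≤ κ * (C * (2 * S ^ 2)) := by
    calc _ ≤ _ := pow_le_pow_left₀ (by positivity) hS 2
      _ ≤ _ := hCS
      _ ≤ κ * (C * (2 * S ^ 2)) := by
        refine mul_le_mul hWκ (hP.trans ?_) (by positivity) hκpos.le
        refine mul_le_mul_of_nonneg_left ?_ hC.le
        nlinarith
  have h2 : κ * (C * (2 * S ^ 2)) = c ^ 2 * e ^ 2 * S ^ 2 / 8 := by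
    rw [hκ]; field_simp; norm_num
  have h3 : 0 < c ^ 2 * e ^ 2 * S ^ 2 := by positivity
  nlinarith

/-! ### Reduced numerators -/

/-- The pairs `(m, n)` with `1 ≤ m ≤ K` for which `n / m` is a simultaneous approximation of `y`
of quality `η / m` all represent one and the same rational vector `a / k`, provided `2 K η ≤ 1`.
Primitivity of `(k, a)` comes from taking the smallest denominator. -/
theorem exists_primitive_approximation {ι : Type*} (y : ι → ℝ) {K η : ℝ}
    (hKη : 2 * K * η ≤ 1) :
    ∃ (k : ℕ) (a : ι → ℤ), (∀ l : ℕ, l.Prime → l ∣ k → ¬ ∀ j, (l : ℤ) ∣ a j) ∧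
      ∀ m : ℕ, 0 < m → (m : ℝ) ≤ K → ∀ n : ι → ℤ, (∀ j, |(n j : ℝ) - m * y j| < η) →
        ∀ j, (k : ℤ) * n j = m * a j := by
  classical
  by_cases hex : ∃ m : ℕ, 0 < m ∧ (m : ℝ) ≤ K ∧ ∃ n : ι → ℤ, ∀ j, |(n j : ℝ) - m * y j| < η
  · obtain ⟨hk, hkK, a, ha⟩ := Nat.find_spec hex
    set k := Nat.find hex
    refine ⟨k, a, ?_, ?_⟩
    · rintro l hl ⟨k₁, hk₁⟩ hdvd
      choose a₁ ha₁ using hdvd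
      have hk₁0 : 0 < k₁ := Nat.pos_of_mul_pos_left (hk₁ ▸ hk)
      have hlt : k₁ < k := by
        rw [hk₁]
        exact (Nat.lt_mul_iff_one_lt_left hk₁0).2 hl.one_lt
      refine Nat.find_min hex hlt ⟨hk₁0, ?_, a₁, fun j => ?_⟩
      · exact le_trans (by exact_mod_cast hlt.le) hkK
      · have h := ha j
        have e : (a j : ℝ) - k * y j = l * ((a₁ j : ℝ) - k₁ * y j) := by
          rw [hk₁, ha₁ j]
          push_cast
          ring
        rw [e, abs_mul, Nat.abs_cast] at h
        have hl1 : (1 : ℝ) ≤ l := by exact_mod_cast hl.one_lt.le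
        nlinarith [abs_nonneg ((a₁ j : ℝ) - k₁ * y j)]
    · intro m hm hmK n hn j
      have h1 := ha j
      have h2 := hn j
      have hη : 0 < η := (abs_nonneg _).trans_lt h1
      have hkR : (0 : ℝ) < k := by exact_mod_cast hk
      have hmR : (0 : ℝ) < m := by exact_mod_cast hm
      have h3 : |(((k : ℤ) * n j - m * a j : ℤ) : ℝ)| < 1 := by
        have e : (((k : ℤ) * n j - m * a j : ℤ) : ℝ) =
            k * ((n j : ℝ) - m * y j) - m * ((a j : ℝ) - k * y j) := by
          push_cast
          ring
        rw [abs_lt] at h1 h2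
        rw [e, abs_lt]
        constructor <;> nlinarith
      have h4 : |(k : ℤ) * n j - m * a j| < 1 := by exact_mod_cast h3
      linarith [Int.abs_lt_one_iff.1 h4]
  · refine ⟨1, 0, fun l hl h1 _ => hl.one_lt.ne' (Nat.dvd_one.1 h1), fun m hm hmK n hn => ?_⟩
    exact absurd ⟨m, hm, hmK, n, hn⟩ hex

/-- `p` is reduced modulo `q` (relative to `a / k`): no prime factor of `q` divides all
coordinates of `k p + a`. For `a = 0`, `k = 1` this says that the fraction `p / q` is in lowest
terms as a vector. -/
def IsReducedNumerator {ι : Type*} (q k : ℕ) (a p : ι → ℤ) : Prop :=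
  ∀ l : ℕ, l.Prime → l ∣ q → ¬ ∀ j, (l : ℤ) ∣ k * p j + a j

/-- If `r / gcd(r, q)` is small, the neighbourhoods of `(p + y) / q` and `(b + y) / r` do not meet
when `b` is reduced: by the choice of `a / k`, meeting would force
`(p + a / k) / q = (b + a / k) / r`, and then `r / gcd(r, q) > 1` divides `k b + a`. -/
theorem IsReducedNumerator.not_both_near {ι : Type*} {q r : ℕ} (hq : 0 < q) (hqr : q < r) {K η : ℝ}
    {y : ι → ℝ} {k : ℕ} {a : ι → ℤ}
    (hka : ∀ m : ℕ, 0 < m → (m : ℝ) ≤ K → ∀ n : ι → ℤ, (∀ j, |(n j : ℝ) - m * y j| < η) →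
        ∀ j, (k : ℤ) * n j = m * a j)
    (hrK : ((r / r.gcd q : ℕ) : ℝ) ≤ K) {α β : ℝ}
    (hη : ((r / r.gcd q : ℕ) : ℝ) * (α + β) ≤ η) {x : ι → ℝ} {p b : ι → ℤ}
    (hp : ∀ j, |(q : ℝ) * x j - p j - y j| < α) (hb : ∀ j, |(r : ℝ) * x j - b j - y j| < β)
    (hbred : IsReducedNumerator r k a b) : False := by
  set d := r.gcd q
  have hd : 0 < d := Nat.gcd_pos_of_pos_right _ hq
  obtain ⟨q', hq'⟩ : d ∣ q := Nat.gcd_dvd_right _ _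
  obtain ⟨r', hr'⟩ : d ∣ r := Nat.gcd_dvd_left _ _
  have hcop : Nat.Coprime r' q' := by
    have := Nat.coprime_div_gcd_div_gcd hd
    rwa [Nat.div_eq_of_eq_mul_right hd hr', Nat.div_eq_of_eq_mul_right hd hq'] at this
  rw [Nat.div_eq_of_eq_mul_right hd hr'] at hrK hη
  have hq'0 : 0 < q' := Nat.pos_of_mul_pos_left (hq' ▸ hq)
  have hqr' : q' < r' := by
    rw [hq', hr'] at hqr
    exact lt_of_mul_lt_mul_left hqr d.zero_le
  have hqR : (q : ℝ) = d * q' := by exact_mod_cast hq'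
  have hrR : (r : ℝ) = d * r' := by exact_mod_cast hr'
  have hqr'R : (q' : ℝ) < r' := by exact_mod_cast hqr'
  have hq'R : (0 : ℝ) < q' := by exact_mod_cast hq'0
  clear_value d
  have hsub : ((r' - q' : ℕ) : ℝ) = r' - q' := Nat.cast_sub hqr'.le
  have hkey := hka (r' - q') (Nat.sub_pos_of_lt hqr') (by rw [hsub]; linarith)
    (fun j => q' * b j - r' * p j) (fun j => by
      have h1 := abs_lt.1 (hp j)
      have h2 := abs_lt.1 (hb j)
      have e : ((q' * b j - r' * p j : ℤ) : ℝ) - ((r' - q' : ℕ) : ℝ) * y j =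
          r' * ((q : ℝ) * x j - p j - y j) - q' * ((r : ℝ) * x j - b j - y j) := by
        rw [hsub, hqR, hrR]
        push_cast
        ring
      rw [e, abs_lt]
      constructor <;> nlinarith)
  have hr'1 : r' ≠ 1 := by omega
  obtain ⟨l, hl, hlr⟩ := Nat.exists_prime_and_dvd hr'1
  refine hbred l hl (hlr.trans ⟨d, by rw [hr', mul_comm]⟩) fun j => ?_
  have h := hkey j
  rw [Nat.cast_sub hqr'.le] at h
  have h' : (r' : ℤ) ∣ q' * (k * b j + a j) := ⟨k * p j + a j, by linear_combination h⟩
  exact (Int.natCast_dvd_natCast.2 hlr).trans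
    (IsCoprime.dvd_of_dvd_mul_left (Nat.isCoprime_iff_coprime.2 hcop) h')

open Classical in
/-- A positive proportion of the lattice points in a square is reduced: the points excluded by a
prime `l` make up a proportion of about `1 / l ^ 2`, and these proportions sum to at
most `3 / 4`. -/
theorem card_isReducedNumerator_ge {q k : ℕ} {a : Fin 2 → ℤ}
    (hprim : ∀ l : ℕ, l.Prime → l ∣ k → ¬ ∀ j, (l : ℤ) ∣ a j) {L : ℝ}
    (hL : 32 + 16 * (q.primeFactors.card : ℝ) ≤ L) {I : Fin 2 → Finset ℤ}
    (hcard : ∀ j, L - 2 ≤ (I j).card)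
    (hdist : ∀ j, ∀ m ∈ I j, ∀ n ∈ I j, ((m - n : ℤ) : ℝ) ≤ L) (hq : q ≠ 0) :
    L ^ 2 / 8 ≤ (((Fintype.piFinset I).filter (IsReducedNumerator q k a)).card : ℝ) := by
  have hω : (0 : ℝ) ≤ q.primeFactors.card := Nat.cast_nonneg _
  have hL0 : 0 ≤ L := by linarith
  set bad : ℕ → Finset (Fin 2 → ℤ) := fun l =>
    Fintype.piFinset fun j => (I j).filter fun n => (l : ℤ) ∣ k * n + a j with hbad
  have hbadcard : ∀ l ∈ q.primeFactors, ((bad l).card : ℝ) ≤ L ^ 2 * (1 / (l : ℝ) ^ 2) + 2 * L := by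
    intro l hl
    have hlp := Nat.prime_of_mem_primeFactors hl
    have hl2 : (2 : ℝ) ≤ l := by exact_mod_cast hlp.two_le
    by_cases hlk : l ∣ k
    · have : bad l = ∅ := by
        refine Finset.eq_empty_of_forall_notMem fun p hp => hprim l hlp hlk fun j => ?_
        have h := (Finset.mem_filter.1 (Fintype.mem_piFinset.1 hp j)).2
        exact (dvd_add_right ((Int.natCast_dvd_natCast.2 hlk).mul_right _)).1 h
      rw [this, Finset.card_empty, Nat.cast_zero]
      positivity
    · have hone : ∀ j, (((I j).filter fun n => (l : ℤ) ∣ k * n + a j).card : ℝ) ≤ L / l + 1 := by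
        intro j
        refine card_le_div_add_one hlp.pos hL0 (fun m hm n hn => ?_) fun m hm n hn =>
          hdist j m (Finset.mem_filter.1 hm).1 n (Finset.mem_filter.1 hn).1
        have h := dvd_sub (Finset.mem_filter.1 hm).2 (Finset.mem_filter.1 hn).2
        have e : (k * m + a j) - (k * n + a j) = (k : ℤ) * (m - n) := by ring
        rw [e] at h
        refine IsCoprime.dvd_of_dvd_mul_left ?_ h
        exact Nat.isCoprime_iff_coprime.2 ((Nat.Prime.coprime_iff_not_dvd hlp).2 hlk)
      rw [hbad, Fintype.card_piFinset, Fin.prod_univ_two, Nat.cast_mul]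
      calc _ ≤ (L / l + 1) * (L / l + 1) :=
            mul_le_mul (hone 0) (hone 1) (Nat.cast_nonneg _) (by positivity)
        _ = L ^ 2 * (1 / (l : ℝ) ^ 2) + 2 * (L / l) + 1 := by field_simp; ring
        _ ≤ _ := by
          have : L / l ≤ L / 2 := by gcongr
          linarith
  have hsplit : Fintype.piFinset I ⊆
      (Fintype.piFinset I).filter (IsReducedNumerator q k a) ∪ q.primeFactors.biUnion bad := by
    intro p hp
    by_cases hred : IsReducedNumerator q k a p
    · exact Finset.mem_union_left _ (Finset.mem_filter.2 ⟨hp, hred⟩)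
    · refine Finset.mem_union_right _ ?_
      unfold IsReducedNumerator at hred
      push Not at hred
      obtain ⟨l, hl, hlq, hdvd⟩ := hred
      exact Finset.mem_biUnion.2 ⟨l, Nat.mem_primeFactors.2 ⟨hl, hlq, hq⟩,
        Fintype.mem_piFinset.2 fun j =>
          Finset.mem_filter.2 ⟨Fintype.mem_piFinset.1 hp j, hdvd j⟩⟩
  have hcount : ((Fintype.piFinset I).card : ℝ) ≤
      ((Fintype.piFinset I).filter (IsReducedNumerator q k a)).card +
        ∑ l ∈ q.primeFactors, ((bad l).card : ℝ) := by
    have := (Finset.card_le_card hsplit).trans ((Finset.card_union_le _ _).trans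
      (Nat.add_le_add_left Finset.card_biUnion_le _))
    exact_mod_cast this
  have hall : (L - 2) ^ 2 ≤ ((Fintype.piFinset I).card : ℝ) := by
    rw [Fintype.card_piFinset, Fin.prod_univ_two, Nat.cast_mul, sq]
    exact mul_le_mul (hcard 0) (hcard 1) (by linarith) (Nat.cast_nonneg _)
  have hsum : ∑ l ∈ q.primeFactors, ((bad l).card : ℝ) ≤
      L ^ 2 * (3 / 4) + q.primeFactors.card * (2 * L) := by
    calc _ ≤ ∑ l ∈ q.primeFactors, (L ^ 2 * (1 / (l : ℝ) ^ 2) + 2 * L) :=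
          Finset.sum_le_sum hbadcard
      _ ≤ _ := by
        rw [Finset.sum_add_distrib, ← Finset.mul_sum, Finset.sum_const, nsmul_eq_mul]
        gcongr
        exact sum_primeFactors_one_div_sq_le q
  nlinarith

/-! ### The reduced approximation sets in the plane -/

/-- The points of `[0, 1)²` that are `α / q`-close, in the maximum norm, to some `(p + y) / q`
with `p` reduced. -/
def reducedNeighborhood (q : ℕ) (α : ℝ) (y : Fin 2 → ℝ) (k : ℕ) (a : Fin 2 → ℤ) :
    Set (Fin 2 → ℝ) :=
  {x | (∀ j, x j ∈ Set.Ico (0 : ℝ) 1) ∧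
    ∃ p : Fin 2 → ℤ, IsReducedNumerator q k a p ∧ ∀ j, |(q : ℝ) * x j - p j - y j| < α}

theorem measurableSet_reducedNeighborhood (q : ℕ) (α : ℝ) (y : Fin 2 → ℝ) (k : ℕ)
    (a : Fin 2 → ℤ) : MeasurableSet (reducedNeighborhood q α y k a) := by
  have e : reducedNeighborhood q α y k a = (⋂ j, {x | x j ∈ Set.Ico (0 : ℝ) 1}) ∩
      ⋃ p : Fin 2 → ℤ, ⋃ _ : IsReducedNumerator q k a p,
        ⋂ j, {x | |(q : ℝ) * x j - p j - y j| < α} := by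
    ext x
    simp only [reducedNeighborhood, Set.mem_ofPred_eq, Set.mem_inter_iff, Set.mem_iInter,
      Set.mem_iUnion, exists_prop]
  rw [e]
  refine (MeasurableSet.iInter fun j => ?_).inter (MeasurableSet.iUnion fun p =>
    MeasurableSet.iUnion fun _ => MeasurableSet.iInter fun j => ?_)
  · exact measurable_pi_apply j measurableSet_Ico
  · exact measurableSet_lt (by fun_prop) measurable_const

theorem reducedNeighborhood_subset (q : ℕ) (α : ℝ) (y : Fin 2 → ℝ) (k : ℕ) (a : Fin 2 → ℤ) :
    reducedNeighborhood q α y k a ⊆ Set.univ.pi fun j => nearGrid q α (y j) := by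
  rintro x ⟨hx, p, -, hp⟩ j -
  exact ⟨hx j, p j, hp j⟩

theorem volume_reducedNeighborhood_ne_top (q : ℕ) (α : ℝ) (y : Fin 2 → ℝ) (k : ℕ)
    (a : Fin 2 → ℤ) : volume (reducedNeighborhood q α y k a) ≠ ⊤ := by
  refine measure_ne_top_of_subset (s := Set.univ.pi fun _ : Fin 2 => Set.Ico (0 : ℝ) 1)
    (fun x hx j _ => hx.1 j) ?_
  simp [Real.volume_pi_Ico]

theorem volume_reducedNeighborhood_inter_le {q r : ℕ} (hq : 0 < q) (hr : 0 < r) {α β : ℝ}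
    (hα0 : 0 ≤ α) (hα : α ≤ 1 / 2) (hβ0 : 0 ≤ β) (hβ : β ≤ 1 / 2) (y : Fin 2 → ℝ) (k k' : ℕ)
    (a a' : Fin 2 → ℤ) :
    volume.real (reducedNeighborhood q α y k a ∩ reducedNeighborhood r β y k' a') ≤
      (24 * α * β + 6 * β / ((r / r.gcd q : ℕ) : ℝ)) ^ 2 := by
  have hfin : ∀ j, volume (nearGrid q α (y j) ∩ nearGrid r β (y j)) ≠ ⊤ := fun j =>
    measure_ne_top_of_subset (s := Set.Ico (0 : ℝ) 1) (fun x hx => hx.1.1) (by simp)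
  have hpi : volume (Set.univ.pi fun j => nearGrid q α (y j) ∩ nearGrid r β (y j)) =
      ∏ j, volume (nearGrid q α (y j) ∩ nearGrid r β (y j)) := volume_pi_pi _
  calc _ ≤ volume.real (Set.univ.pi fun j => nearGrid q α (y j) ∩ nearGrid r β (y j)) := by
        refine measureReal_mono (fun x hx j hj => ?_) ?_
        · exact ⟨reducedNeighborhood_subset q α y k a hx.1 j hj,
            reducedNeighborhood_subset r β y k' a' hx.2 j hj⟩
        · rw [hpi]
          exact ENNReal.prod_ne_top fun j _ => hfin j
    _ = ∏ j, volume.real (nearGrid q α (y j) ∩ nearGrid r β (y j)) := by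
        rw [Measure.real, hpi, ENNReal.toReal_prod]
        rfl
    _ ≤ ∏ _j : Fin 2, (24 * α * β + 6 * β / ((r / r.gcd q : ℕ) : ℝ)) :=
        Finset.prod_le_prod (fun _ _ => measureReal_nonneg)
          fun j _ => volume_nearGrid_inter_le hq hr hα0 hα hβ0 hβ
    _ = _ := by simp

/-- A closed ball in the open unit square meets the reduced neighbourhood in a proportion of at
least `α ^ 2 / 2` as soon as `q` is large compared with the radius. -/
theorem volume_reducedNeighborhood_inter_closedBall_ge {q k : ℕ} {a : Fin 2 → ℤ}
    (hprim : ∀ l : ℕ, l.Prime → l ∣ k → ¬ ∀ j, (l : ℤ) ∣ a j) (hq : 0 < q) {α : ℝ}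
    (hα0 : 0 ≤ α) (hα : α ≤ 1 / 2) (y : Fin 2 → ℝ) {z : Fin 2 → ℝ} {ρ : ℝ}
    (hball : Metric.closedBall z ρ ⊆ Set.univ.pi fun _ => Set.Ioo (0 : ℝ) 1)
    (hρ : 32 + 16 * (q.primeFactors.card : ℝ) ≤ 2 * q * ρ) :
    1 / 2 * α ^ 2 * volume.real (Metric.closedBall z ρ) ≤
      volume.real (reducedNeighborhood q α y k a ∩ Metric.closedBall z ρ) := by
  classical
  rcases hα0.eq_or_lt with rfl | hαpos
  · simp
  have hqR : (0 : ℝ) < q := by exact_mod_cast hq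
  have hω : (0 : ℝ) ≤ q.primeFactors.card := Nat.cast_nonneg _
  have hρpos : 0 < ρ := by
    by_contra! h
    nlinarith
  -- The margin `1 / 2 ≥ α` keeps the small balls inside the closed ball of radius `ρ`.
  set I : Fin 2 → Finset ℤ := fun j =>
    Finset.Icc ⌈q * z j - y j - (q * ρ - 1 / 2)⌉ ⌊q * z j - y j + (q * ρ - 1 / 2)⌋ with hI
  have hmem : ∀ j, ∀ n ∈ I j, q * z j - y j - (q * ρ - 1 / 2) ≤ n ∧
      (n : ℝ) ≤ q * z j - y j + (q * ρ - 1 / 2) := fun j n hn =>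
    ⟨Int.ceil_le.1 (Finset.mem_Icc.1 hn).1, Int.le_floor.1 (Finset.mem_Icc.1 hn).2⟩
  have hcount := card_isReducedNumerator_ge (I := I) hprim hρ (fun j => by
      rw [hI, Int.card_Icc]
      have h1 := Int.ceil_lt_add_one (q * z j - y j - (q * ρ - 1 / 2))
      have h2 := Int.sub_one_lt_floor (q * z j - y j + (q * ρ - 1 / 2))
      have h3 := Int.self_le_toNat (⌊q * z j - y j + (q * ρ - 1 / 2)⌋ + 1 -
        ⌈q * z j - y j - (q * ρ - 1 / 2)⌉)
      have h4 : ((⌊q * z j - y j + (q * ρ - 1 / 2)⌋ + 1 -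
        ⌈q * z j - y j - (q * ρ - 1 / 2)⌉ : ℤ) : ℝ) ≤ ((⌊q * z j - y j + (q * ρ - 1 / 2)⌋ + 1 -
        ⌈q * z j - y j - (q * ρ - 1 / 2)⌉).toNat : ℝ) := by exact_mod_cast h3
      push_cast at h4
      linarith) (fun j m hm n hn => by
      have h1 := hmem j m hm
      have h2 := hmem j n hn
      push_cast
      linarith) hq.ne'
  set F := (Fintype.piFinset I).filter (IsReducedNumerator q k a)
  set c : (Fin 2 → ℤ) → (Fin 2 → ℝ) := fun p j => ((p j : ℝ) + y j) / q with hc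
  have hcoord : ∀ p x, x ∈ Metric.ball (c p) (α / q) → ∀ j, |(q : ℝ) * x j - p j - y j| < α := by
    intro p x hx j
    have h := (dist_pi_lt_iff (by positivity)).1 (Metric.mem_ball.1 hx) j
    rw [Real.dist_eq] at h
    have e : (q : ℝ) * x j - p j - y j = q * (x j - c p j) := by
      simp only [hc]
      field_simp
      ring
    rw [e, abs_mul, abs_of_pos hqR]
    rwa [lt_div_iff₀' hqR] at h
  have hsub : (⋃ p ∈ F, Metric.ball (c p) (α / q)) ⊆
      reducedNeighborhood q α y k a ∩ Metric.closedBall z ρ := by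
    refine Set.iUnion₂_subset fun p hp x hx => ?_
    have hpF := Finset.mem_filter.1 hp
    have hxp := hcoord p x hx
    have hxz : x ∈ Metric.closedBall z ρ := by
      rw [Metric.mem_closedBall, dist_pi_le_iff hρpos.le]
      intro j
      have h1 := hmem j (p j) (Fintype.mem_piFinset.1 hpF.1 j)
      have h2 := abs_lt.1 (hxp j)
      rw [Real.dist_eq, abs_le]
      constructor <;> nlinarith
    refine ⟨⟨fun j => ?_, p, hpF.2, hxp⟩, hxz⟩
    exact Set.Ioo_subset_Ico_self (hball hxz j (Set.mem_univ j))
  have hdisj : (F : Set (Fin 2 → ℤ)).PairwiseDisjoint fun p => Metric.ball (c p) (α / q) := by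
    intro p _ p' _ hne
    refine Set.disjoint_left.2 fun x hx hx' => hne (funext fun j => ?_)
    have h1 := abs_lt.1 (hcoord p x hx j)
    have h2 := abs_lt.1 (hcoord p' x hx' j)
    have h3 : |((p j - p' j : ℤ) : ℝ)| < 1 := by
      push_cast
      rw [abs_lt]
      constructor <;> linarith
    have h4 : |p j - p' j| < 1 := by exact_mod_cast h3
    linarith [Int.abs_lt_one_iff.1 h4]
  have hvol : ∀ p ∈ F, volume.real (Metric.ball (c p) (α / q)) = (2 * (α / q)) ^ 2 := by
    intro p _
    rw [Measure.real, Real.volume_pi_ball _ (by positivity), ENNReal.toReal_ofReal (by positivity)]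
    simp
  calc 1 / 2 * α ^ 2 * volume.real (Metric.closedBall z ρ)
      = (2 * q * ρ) ^ 2 / 8 * (2 * (α / q)) ^ 2 := by
        rw [Measure.real, Real.volume_pi_closedBall _ hρpos.le,
          ENNReal.toReal_ofReal (by positivity)]
        simp only [Fintype.card_fin]
        field_simp
        ring
    _ ≤ F.card * (2 * (α / q)) ^ 2 := by gcongr
    _ = volume.real (⋃ p ∈ F, Metric.ball (c p) (α / q)) := by
        rw [measureReal_biUnion_finset hdisj (fun _ _ => measurableSet_ball)
          (fun _ _ => measure_ball_lt_top.ne), Finset.sum_congr rfl hvol, Finset.sum_const,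
          nsmul_eq_mul]
    _ ≤ _ := measureReal_mono hsub
        (measure_ne_top_of_subset Set.inter_subset_left
          (volume_reducedNeighborhood_ne_top q α y k a))

/-! ### Quasi-independence on average and full measure -/

/-- The double sum over `s` of a symmetric function is controlled by its diagonal and by its
values above the diagonal, here bounded by `C₁ w_q w_r + C₂ w_r h(q, r)`. -/
theorem sum_sum_le_of_symm {f h : ℕ → ℕ → ℝ} {w : ℕ → ℝ} {C₀ C₁ C₂ D : ℝ} (s : Finset ℕ)
    (hw : ∀ q ∈ s, 0 ≤ w q) (hC₁ : 0 ≤ C₁) (hC₂ : 0 ≤ C₂) (hh : ∀ q r, 0 ≤ h q r)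
    (hsymm : ∀ q r, f q r = f r q)
    (hdiag : ∀ q ∈ s, f q q ≤ C₀ * w q)
    (hoff : ∀ q ∈ s, ∀ r ∈ s, q < r → f q r ≤ C₁ * w q * w r + C₂ * w r * h q r)
    (hD : ∀ r ∈ s, ∑ q ∈ Finset.range r, h q r ≤ D) :
    ∑ q ∈ s, ∑ r ∈ s, f q r ≤
      (C₀ + 2 * C₂ * D) * ∑ q ∈ s, w q + 2 * C₁ * (∑ q ∈ s, w q) ^ 2 := by
  set S := ∑ q ∈ s, w q
  set g : ℕ → ℕ → ℝ := fun q r => C₁ * w q * w r + C₂ * w r * (if q < r then h q r else 0) with hg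
  have hg0 : ∀ q ∈ s, ∀ r ∈ s, 0 ≤ g q r := by
    intro q hq r hr
    have h1 := hw q hq
    have h2 := hw r hr
    have h3 : 0 ≤ if q < r then h q r else 0 := by
      split_ifs
      exacts [hh q r, le_rfl]
    simp only [hg]
    positivity
  have hfg : ∀ q ∈ s, ∀ r ∈ s,
      f q r ≤ (if q = r then C₀ * w q else 0) + g q r + g r q := by
    intro q hq r hr
    have h1 := hg0 q hq r hr
    have h2 := hg0 r hr q hq
    rcases lt_trichotomy q r with hlt | rfl | hlt
    · have h3 := hoff q hq r hr hlt
      have h4 : g q r = C₁ * w q * w r + C₂ * w r * h q r := by simp [hg, hlt]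
      rw [if_neg hlt.ne]
      linarith
    · have h3 := hdiag q hq
      rw [if_pos rfl]
      linarith
    · have h3 := hoff r hr q hq hlt
      have h4 : g r q = C₁ * w r * w q + C₂ * w q * h r q := by simp [hg, hlt]
      rw [if_neg hlt.ne', hsymm]
      linarith
  have hgsum : ∑ r ∈ s, ∑ q ∈ s, g q r ≤ C₁ * S ^ 2 + C₂ * D * S := by
    calc _ ≤ ∑ r ∈ s, (C₁ * S * w r + C₂ * D * w r) := by
          refine Finset.sum_le_sum fun r hr => ?_
          have h1 : ∑ q ∈ s, (if q < r then h q r else 0) ≤ D := by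
            rw [← Finset.sum_filter]
            refine le_trans (Finset.sum_le_sum_of_subset_of_nonneg (fun q hq => ?_)
              fun q _ _ => hh q r) (hD r hr)
            exact Finset.mem_range.2 (Finset.mem_filter.1 hq).2
          simp only [hg]
          rw [Finset.sum_add_distrib, ← Finset.mul_sum, ← Finset.sum_mul, ← Finset.mul_sum]
          have h2 := mul_le_mul_of_nonneg_left h1 (mul_nonneg hC₂ (hw r hr))
          linarith
      _ = C₁ * S ^ 2 + C₂ * D * S := by
          rw [Finset.sum_add_distrib, ← Finset.mul_sum, ← Finset.mul_sum]
          ring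
  calc _ ≤ ∑ q ∈ s, ∑ r ∈ s, ((if q = r then C₀ * w q else 0) + g q r + g r q) :=
        Finset.sum_le_sum fun q hq => Finset.sum_le_sum fun r hr => hfg q hq r hr
    _ = C₀ * S + ∑ r ∈ s, ∑ q ∈ s, g q r + ∑ r ∈ s, ∑ q ∈ s, g q r := by
        simp only [Finset.sum_add_distrib]
        rw [Finset.sum_comm (f := fun q r => g q r)]
        congr 2
        rw [Finset.mul_sum]
        refine Finset.sum_congr rfl fun q hq => ?_
        rw [Finset.sum_ite_eq, if_pos hq]
    _ ≤ _ := by linarith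

theorem eventually_card_primeFactors_le {ρ : ℝ} (hρ : 0 < ρ) :
    ∀ᶠ q : ℕ in atTop, 32 + 16 * (q.primeFactors.card : ℝ) ≤ 2 * q * ρ := by
  obtain ⟨C, hC, hdiv⟩ := exists_card_divisors_le_rpow (ε := 1 / 2) (by norm_num)
  have ht : Tendsto (fun q : ℕ => (q : ℝ) ^ (1 / 2 : ℝ)) atTop atTop :=
    (tendsto_rpow_atTop (by norm_num)).comp tendsto_natCast_atTop_atTop
  filter_upwards [ht.eventually_ge_atTop 1, ht.eventually_ge_atTop ((8 * C + 16) / ρ),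
    eventually_gt_atTop 0] with q h1 h2 hq
  set t := (q : ℝ) ^ (1 / 2 : ℝ)
  have hω : (q.primeFactors.card : ℝ) ≤ C * t := by
    refine le_trans ?_ (hdiv q hq.ne')
    exact_mod_cast Finset.card_le_card fun p hp => Nat.mem_divisors.2
      ⟨Nat.dvd_of_mem_primeFactors hp, hq.ne'⟩
  have hqt : (q : ℝ) = t * t := by
    rw [← Real.rpow_add (by exact_mod_cast hq)]
    norm_num
  rw [div_le_iff₀ hρ] at h2
  rw [hqt]
  nlinarith

/-- The decay `ψ(q) ≪ q ^ (-δ)` makes the neighbourhoods so narrow, when `r / gcd(r, q) ≤ r ^ ε`,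
that an overlap forces a simultaneous approximation of `y` of quality `r ^ (-ε) / 2`. -/
theorem mul_add_le_of_decay {δ ε C : ℝ} (hδ : 0 < δ) (hε : ε * (δ + 2) = δ / 2) (hC : 0 < C)
    {q r : ℕ} (hq : 0 < q) (hqr : q < r) (hCr : 4 * C ≤ (r : ℝ) ^ (δ / 2)) {α β : ℝ}
    (hα : α ≤ C * (q : ℝ) ^ (-δ)) (hβ : β ≤ C * (r : ℝ) ^ (-δ)) (hβ0 : 0 ≤ α + β)
    (hrK : ((r / r.gcd q : ℕ) : ℝ) ≤ (r : ℝ) ^ ε) :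
    ((r / r.gcd q : ℕ) : ℝ) * (α + β) ≤ (r : ℝ) ^ (-ε) / 2 := by
  have hr : (0 : ℝ) < r := by exact_mod_cast hq.trans hqr
  have hr1 : (1 : ℝ) ≤ r := by exact_mod_cast hq.trans hqr
  have hqd : (r : ℝ) ^ (1 - ε) ≤ q := by
    have h1 : (r : ℝ) = (r.gcd q : ℝ) * ((r / r.gcd q : ℕ) : ℝ) := by
      exact_mod_cast (Nat.mul_div_cancel' (Nat.gcd_dvd_left r q)).symm
    have h2 : (r.gcd q : ℝ) ≤ q := by exact_mod_cast Nat.gcd_le_right r hq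
    rw [Real.rpow_sub hr, Real.rpow_one, div_le_iff₀ (by positivity)]
    calc (r : ℝ) = (r.gcd q : ℝ) * ((r / r.gcd q : ℕ) : ℝ) := h1
      _ ≤ q * (r : ℝ) ^ ε := by gcongr
  have hε0 : 0 ≤ ε := by
    by_contra! h
    nlinarith
  have h1 : (q : ℝ) ^ (-δ) ≤ (r : ℝ) ^ (-δ * (1 - ε)) := by
    calc (q : ℝ) ^ (-δ) ≤ ((r : ℝ) ^ (1 - ε)) ^ (-δ) :=
          Real.rpow_le_rpow_of_nonpos (by positivity) hqd (by linarith)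
      _ = _ := by rw [← Real.rpow_mul hr.le, mul_comm]
  have h2 : (r : ℝ) ^ (-δ) ≤ (r : ℝ) ^ (-δ * (1 - ε)) :=
    Real.rpow_le_rpow_of_exponent_le hr1 (by nlinarith)
  have h3 : (r : ℝ) ^ (-ε) = (r : ℝ) ^ ε * (r : ℝ) ^ (-δ * (1 - ε)) * (r : ℝ) ^ (δ / 2) := by
    rw [← Real.rpow_add hr, ← Real.rpow_add hr]
    congr 1
    linarith
  calc _ ≤ (r : ℝ) ^ ε * (2 * C * (r : ℝ) ^ (-δ * (1 - ε))) := by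
        refine mul_le_mul hrK ?_ hβ0 (by positivity)
        have h4 := mul_le_mul_of_nonneg_left h1 hC.le
        have h5 := mul_le_mul_of_nonneg_left h2 hC.le
        linarith
    _ = (r : ℝ) ^ ε * (r : ℝ) ^ (-δ * (1 - ε)) * (4 * C) / 2 := by ring
    _ ≤ _ := by
        rw [h3]
        gcongr

theorem volume_unitSquare_Ioo :
    volume (Set.univ.pi fun _ : Fin 2 => Set.Ioo (0 : ℝ) 1) = 1 := by
  simp [Real.volume_pi_Ioo]

theorem volume_approximableVectors_eq_one {δ : ℝ} (hδ : 0 < δ) {ψ : ℕ → ℝ≥0}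
    (hψ : (fun q : ℕ => (ψ q : ℝ)) =O[atTop] (fun q : ℕ => (q : ℝ) ^ (-δ)))
    (y : Fin 2 → ℝ) (hdiv : ¬ Summable (fun q : ℕ => (ψ q : ℝ) ^ 2)) :
    volume (approximableVectors 2 ψ y) = 1 := by
  obtain ⟨C, hC, hCψ⟩ := hψ.exists_pos
  -- The exponent for which `δ (1 - ε) - 2 ε = δ / 2`.
  set ε : ℝ := δ / (2 * (2 + δ)) with hεdef
  have hε : 0 < ε := by positivity
  have hεδ : ε * (δ + 2) = δ / 2 := by
    rw [hεdef]
    field_simp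
    ring
  have htend : Tendsto (fun q : ℕ => (q : ℝ) ^ (δ / 2)) atTop atTop :=
    (tendsto_rpow_atTop (by positivity)).comp tendsto_natCast_atTop_atTop
  have hlarge : ∀ᶠ q : ℕ in atTop, 0 < q ∧ (ψ q : ℝ) ≤ C * (q : ℝ) ^ (-δ) ∧
      4 * C ≤ (q : ℝ) ^ (δ / 2) ∧ (ψ q : ℝ) ≤ 1 / 2 := by
    filter_upwards [eventually_gt_atTop 0, hCψ.bound, htend.eventually_ge_atTop (4 * C)]
      with q hq h1 h2
    have hqR : (1 : ℝ) ≤ q := by exact_mod_cast hq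
    rw [Real.norm_of_nonneg (ψ q).coe_nonneg, Real.norm_of_nonneg (by positivity)] at h1
    refine ⟨hq, h1, h2, h1.trans ?_⟩
    have h3 : (q : ℝ) ^ (δ / 2) ≤ (q : ℝ) ^ δ :=
      Real.rpow_le_rpow_of_exponent_le hqR (by linarith)
    rw [Real.rpow_neg (by positivity), ← div_eq_mul_inv, div_le_iff₀ (by positivity)]
    linarith
  obtain ⟨N₀, hN₀⟩ := eventually_atTop.1 hlarge
  have hprimitive := fun r : ℕ => exists_primitive_approximation y (K := (r : ℝ) ^ ε)
    (η := (r : ℝ) ^ (-ε) / 2) (by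
      rcases r.eq_zero_or_pos with rfl | hr
      · rw [Nat.cast_zero, Real.zero_rpow hε.ne']
        norm_num
      · have hr' : (0 : ℝ) < r := by exact_mod_cast hr
        rw [Real.rpow_neg hr'.le]
        field_simp
        norm_num)
  choose k a hprim hka using hprimitive
  set A : ℕ → Set (Fin 2 → ℝ) := fun q => reducedNeighborhood q (ψ q) y (k q) (a q)
  obtain ⟨D, hD0, hD⟩ := exists_sum_one_div_sq_le hε
  set h : ℕ → ℕ → ℝ := fun q r =>
    if (r : ℝ) ^ ε < ((r / r.gcd q : ℕ) : ℝ) then 1 / ((r / r.gcd q : ℕ) : ℝ) ^ 2 else 0 with hh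
  have hh0 : ∀ q r, 0 ≤ h q r := by
    intro q r
    simp only [hh]
    split_ifs <;> positivity
  have hψ0 : ∀ q, (0 : ℝ) ≤ ψ q := fun q => (ψ q).coe_nonneg
  -- The one-dimensional overlap bound, squared: `18 = 24 / 2 + 6` on the diagonal, where `ψ ≤ 1 / 2`,
  -- and `1152 = 2 * 24 ^ 2`, `72 = 2 * 6 ^ 2` off the diagonal.
  have hdiag : ∀ q, N₀ ≤ q → volume.real (A q ∩ A q) ≤ 324 * (ψ q : ℝ) ^ 2 := by
    intro q hq
    obtain ⟨hq0, -, -, hq2⟩ := hN₀ q hq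
    refine (volume_reducedNeighborhood_inter_le hq0 hq0 (hψ0 q) hq2 (hψ0 q) hq2 y _ _ _ _).trans ?_
    rw [Nat.gcd_self, Nat.div_self hq0, Nat.cast_one, div_one]
    have h1 := hψ0 q
    calc _ ≤ (18 * (ψ q : ℝ)) ^ 2 := pow_le_pow_left₀ (by positivity) (by nlinarith) 2
      _ = _ := by ring
  have hoff : ∀ q r, N₀ ≤ q → N₀ ≤ r → q < r → volume.real (A q ∩ A r) ≤
      1152 * (ψ q : ℝ) ^ 2 * (ψ r : ℝ) ^ 2 + 72 * (ψ r : ℝ) ^ 2 * h q r := by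
    intro q r hq hr hqr
    obtain ⟨hq0, hq1, -, hq2⟩ := hN₀ q hq
    obtain ⟨hr0, hr1, hr3, hr2⟩ := hN₀ r hr
    by_cases hbig : (r : ℝ) ^ ε < ((r / r.gcd q : ℕ) : ℝ)
    · refine (volume_reducedNeighborhood_inter_le hq0 hr0 (hψ0 q) hq2 (hψ0 r) hr2 y
        _ _ _ _).trans ?_
      simp only [hh, if_pos hbig]
      refine (add_sq_le (a := 24 * (ψ q : ℝ) * ψ r)).trans_eq ?_
      ring
    · have hempty : A q ∩ A r = ∅ := by
        refine Set.eq_empty_of_forall_notMem ?_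
        rintro x ⟨⟨-, p, -, hp⟩, -, b, hbred, hb⟩
        exact hbred.not_both_near hq0 hqr (hka r) (not_lt.1 hbig)
          (mul_add_le_of_decay hδ hεδ hC hq0 hqr hr3 hq1 hr1 (add_nonneg (hψ0 q) (hψ0 r))
            (not_lt.1 hbig)) hp hb
      rw [hempty, measureReal_empty]
      have := hh0 q r
      positivity
  have hnull := volume_diff_limsup_eq_zero (Ω := Set.univ.pi fun _ : Fin 2 => Set.Ioo (0 : ℝ) 1)
    (isOpen_set_pi Set.finite_univ fun _ _ => isOpen_Ioo)
    (by rw [volume_unitSquare_Ioo]; exact ENNReal.one_ne_top) (A := A)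
    (fun q => measurableSet_reducedNeighborhood q _ y _ _)
    (fun q => volume_reducedNeighborhood_ne_top q _ y _ _)
    (w := fun q => (ψ q : ℝ) ^ 2) (fun q => by positivity) hdiv
    (c := 1 / 2) (C := 2628 + 144 * D) (by norm_num) (by positivity) N₀
    (fun N Q hN => by
      have hge : ∀ q ∈ Finset.Ico N Q, N₀ ≤ q := fun q hq => hN.trans (Finset.mem_Ico.1 hq).1
      refine (sum_sum_le_of_symm (Finset.Ico N Q) (w := fun q => (ψ q : ℝ) ^ 2) (h := h)
        (C₀ := 324) (C₁ := 1152) (C₂ := 72) (D := D) (fun q _ => by positivity) (by norm_num)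
        (by norm_num) hh0 (fun q r => by rw [Set.inter_comm]) (fun q hq => hdiag q (hge q hq))
        (fun q hq r hr => hoff q r (hge q hq) (hge r hr)) (fun r hr => ?_)).trans ?_
      · simp only [hh]
        rw [← Finset.sum_filter]
        exact hD r (hN₀ r (hge r hr)).1.ne'
      · have hS : 0 ≤ ∑ q ∈ Finset.Ico N Q, (ψ q : ℝ) ^ 2 :=
          Finset.sum_nonneg fun _ _ => by positivity
        nlinarith [sq_nonneg (∑ q ∈ Finset.Ico N Q, (ψ q : ℝ) ^ 2),
          mul_nonneg hD0.le (sq_nonneg (∑ q ∈ Finset.Ico N Q, (ψ q : ℝ) ^ 2))])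
    (fun z ρ hρ hball => by
      filter_upwards [eventually_card_primeFactors_le hρ, eventually_ge_atTop N₀] with q h1 h2
      obtain ⟨hq0, -, -, hq2⟩ := hN₀ q h2
      exact volume_reducedNeighborhood_inter_closedBall_ge (hprim q) hq0 (hψ0 q) hq2 y hball h1)
  have hlimsup : {x | ∃ᶠ q in atTop, x ∈ A q} ⊆ approximableVectors 2 ψ y := by
    intro x hx
    obtain ⟨q₀, hq₀⟩ := hx.exists
    refine ⟨hq₀.1, Set.Infinite.of_image Prod.fst ?_⟩
    refine (Nat.frequently_atTop_iff_infinite.1 (hx.and_eventually (eventually_gt_atTop 0))).mono ?_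
    rintro q ⟨⟨-, p, -, hp⟩, hq⟩
    refine ⟨(q, p), ⟨hq, ?_⟩, rfl⟩
    exact (pi_norm_lt_iff ((abs_nonneg _).trans_lt (hp 0))).2 hp
  refine le_antisymm ?_ ?_
  · calc volume (approximableVectors 2 ψ y)
        ≤ volume (Set.univ.pi fun _ : Fin 2 => Set.Ico (0 : ℝ) 1) :=
          measure_mono fun x hx j _ => hx.1 j
      _ = 1 := by simp [Real.volume_pi_Ico]
  · rw [← volume_unitSquare_Ioo]
    exact (measure_mono_ae (ae_le_set.2 hnull)).trans (measure_mono hlimsup)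

/-- A `1 × m` matrix is approximable as soon as its row is an approximable vector. -/
theorem preimage_approximableVectors_subset (m : ℕ) (ψ : ℕ → ℝ≥0) (y : Fin m → ℝ) :
    (MeasurableEquiv.funUnique (Fin 1) (Fin m → ℝ)) ⁻¹' approximableVectors m ψ y ⊆
      approximableMatrices 1 m ψ y := by
  rintro x ⟨hx, hinf⟩
  refine ⟨fun i j => ?_, ?_⟩
  · rw [Subsingleton.elim i 0]
    exact hx j
  · have hinj : Function.Injective
        (fun qp : ℕ × (Fin m → ℤ) => ((fun _ => (qp.1 : ℤ) : Fin 1 → ℤ), qp.2)) := by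
      intro s t hst
      obtain ⟨h1, h2⟩ := Prod.mk.inj hst
      exact Prod.ext (by exact_mod_cast congrFun h1 0) h2
    refine (hinf.image hinj.injOn).mono ?_
    rintro _ ⟨⟨q, p⟩, ⟨hq, hqp⟩, rfl⟩
    refine ⟨fun h0 => ?_, ?_⟩
    · have := congrFun h0 0
      simp only [Pi.zero_apply, Nat.cast_eq_zero] at this
      omega
    · have e : intMaxNorm (fun _ => (q : ℤ) : Fin 1 → ℤ) = q := by simp [intMaxNorm]
      simp only [e, Finset.univ_unique, Finset.sum_singleton, Int.cast_natCast]
      exact hqp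

theorem theorem1 (δ : ℝ) (hδ : 0 < δ) (ψ : ℕ → ℝ≥0)
    (hψ : (fun q : ℕ => (ψ q : ℝ)) =O[atTop] (fun q : ℕ => (q : ℝ) ^ (-δ)))
    (y : Fin 2 → ℝ)
    (hdiv : ¬ Summable (fun q : ℕ => (ψ q : ℝ) ^ 2)) :
    volume (approximableMatrices 1 2 ψ y) = 1 ∧ volume (approximableVectors 2 ψ y) = 1 := by
  have hvec := volume_approximableVectors_eq_one hδ hψ y hdiv
  refine ⟨le_antisymm ?_ ?_, hvec⟩
  · calc volume (approximableMatrices 1 2 ψ y)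
        ≤ volume (Set.univ.pi fun _ : Fin 1 => Set.univ.pi fun _ : Fin 2 => Set.Ico (0 : ℝ) 1) :=
          measure_mono fun x hx i _ j _ => hx.1 i j
      _ = 1 := by
        rw [volume_pi_pi]
        simp [Real.volume_pi_Ico]
  · rw [← hvec, ← (volume_preserving_funUnique (Fin 1) (Fin 2 → ℝ)).measure_preimage_equiv]
    exact measure_mono (preimage_approximableVectors_subset 2 ψ y)
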